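/- Let $N\ge 1$ be an integer and $\eta>0$ a real number. For $E=\mathrm{diag}(E_1,\dots,E_N)$ with $E_i>0$ for all $i$ and $E_i\ne E_j$ for $i\ne j$, let $$Z(E,\eta)=\int d\Phi\; e^{-N\,\mathrm{Tr}\left(E\Phi^2+\frac{\eta}{4}\Phi^4\right)},$$ where the integral runs over all Hermitian $N\times N$ matrices $\Phi$ with respect to the Lebesgue measure $d\Phi=\prod_i d\Phi_{ii}\prod_{k<l} d\,\mathrm{Re}\,\Phi_{kl}\; d\,\mathrm{Im}\,\Phi_{kl}$, and let $\Delta(E)=\prod_{k<l}(E_l-E_k)$ be the Vandermonde determinant. Then the integral converges absolutely, and the function $$\Psi(E,\eta)=e^{-\frac{N}{2\eta}\sum_{i=1}^N E_i^2}\,\Delta(E)\,Z(E,\eta)$$ is a twice continuously differentiable function of $(E_1,\dots,E_N)$ on the set of positive, pairwise distinct $E_1,\dots,E_N$, and is there a zero-energy solution of the Schrödinger equation of $N$ non-interacting harmonic oscillators: $$\left[-\frac{\eta}{N}\sum_{i=1}^N\frac{\partial^2}{\partial E_i^2}+\frac{N}{\eta}\sum_{i=1}^N E_i^2\right]\Psi(E,\eta)=0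 .$$ -/

import Mathlib

open MeasureTheory

noncomputable section

namespace PhiFour

/-- Index pairs `(k, l)` with `k < l`, i.e. the positions above the diagonal. -/
abbrev UpperPair (N : ℕ) : Type := {p : Fin N × Fin N // p.1 < p.2}

/-- The real coordinates of a Hermitian `N × N` matrix `Φ`: the diagonal entries `Φ_ii`, the real
parts and the imaginary parts of the entries `Φ_kl` with `k < l`. Its `volume` is the product
Lebesgue measure `∏ dΦ_ii ∏_{k<l} dΦ_kl^Re dΦ_kl^Im`. -/
abbrev HermCoord (N : ℕ) : Type :=
  (Fin N → ℝ) × (UpperPair N → ℝ) × (UpperPair N → ℝ)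

/-- The Hermitian matrix with the given real coordinates. -/
def toMatrix {N : ℕ} (x : HermCoord N) : Matrix (Fin N) (Fin N) ℂ :=
  Matrix.of fun i j =>
    if h : i < j then (⟨x.2.1 ⟨(i, j), h⟩, x.2.2 ⟨(i, j), h⟩⟩ : ℂ)
    else if h' : j < i then (⟨x.2.1 ⟨(j, i), h'⟩, -x.2.2 ⟨(j, i), h'⟩⟩ : ℂ)
    else ((x.1 i : ℝ) : ℂ)

theorem toMatrix_isHermitian {N : ℕ} (x : HermCoord N) : (toMatrix x).IsHermitian := by
  ext i j
  rcases lt_trichotomy i j with h | h | h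
  · simp [toMatrix, Matrix.conjTranspose_apply, h, h.not_gt, Complex.ext_iff]
  · subst h
    simp [toMatrix, Matrix.conjTranspose_apply]
  · simp [toMatrix, Matrix.conjTranspose_apply, h, h.not_gt, Complex.ext_iff]

/-- The complex number `N Tr (E Φ² + (η/4) Φ⁴)` for `E = diag (E_1, …, E_N)`. -/
def actionC {N : ℕ} (η : ℝ) (E : Fin N → ℝ) (Φ : Matrix (Fin N) (Fin N) ℂ) : ℂ :=
  (N : ℂ) * (Matrix.diagonal (fun i => (E i : ℂ)) * Φ ^ 2 + ((η / 4 : ℝ) : ℂ) • Φ ^ 4).trace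

/-- On Hermitian matrices the action is real, so that taking its real part below loses nothing. -/
theorem actionC_im {N : ℕ} (η : ℝ) (E : Fin N → ℝ) (Φ : Matrix (Fin N) (Fin N) ℂ)
    (hΦ : Φ.IsHermitian) : (actionC η E Φ).im = 0 := by
  have hD : (Matrix.diagonal (fun i => (E i : ℂ))).IsHermitian := by
    rw [Matrix.IsHermitian, Matrix.diagonal_conjTranspose]
    congr 1
    ext i
    simp
  rw [← Complex.conj_eq_iff_im, actionC, map_mul, map_natCast, starRingEnd_apply,
    ← Matrix.trace_conjTranspose, Matrix.conjTranspose_add, Matrix.conjTranspose_mul,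
    Matrix.conjTranspose_smul, hD.eq, (hΦ.pow 2).eq, (hΦ.pow 4).eq, Matrix.trace_add,
    Matrix.trace_mul_comm, Matrix.trace_add]
  simp

/-- The action `S' = N Tr (E Φ² + (η/4) Φ⁴)`. -/
def action {N : ℕ} (η : ℝ) (E : Fin N → ℝ) (Φ : Matrix (Fin N) (Fin N) ℂ) : ℝ :=
  (actionC η E Φ).re

/-- The weight `e^{-S'}` as a function of the coordinates of `Φ`. -/
def weight {N : ℕ} (η : ℝ) (E : Fin N → ℝ) (x : HermCoord N) : ℝ :=
  Real.exp (-action η E (toMatrix x))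

/-- The partition function `Z(E, η) = ∫ dΦ e^{-S'}`. -/
def Z {N : ℕ} (η : ℝ) (E : Fin N → ℝ) : ℝ := ∫ x : HermCoord N, weight η E x

/-- The Vandermonde determinant `Δ(E) = ∏_{k<l} (E_l - E_k)`. -/
def vandermondeDet {N : ℕ} (E : Fin N → ℝ) : ℝ :=
  ∏ k : Fin N, ∏ l ∈ Finset.Ioi k, (E l - E k)

/-- `Ψ(E, η) = e^{-(N/2η) ∑ E_i²} Δ(E) Z(E, η)`. -/
def Psi {N : ℕ} (η : ℝ) (E : Fin N → ℝ) : ℝ :=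
  Real.exp (-((N : ℝ) / (2 * η)) * ∑ i, E i ^ 2) * vandermondeDet E * Z η E

/-- The pure second partial derivative `∂²f/∂E_i²` at `E`. -/
def secondPartial {N : ℕ} (i : Fin N) (f : (Fin N → ℝ) → ℝ) (E : Fin N → ℝ) : ℝ :=
  iteratedDeriv 2 (fun t : ℝ => f (Function.update E i t)) (E i)

/-- The Hamiltonian of `N` non-interacting harmonic oscillators,
`H_HO = -(η/N) ∑ ∂²/∂E_i² + (N/η) ∑ E_i²`, acting on functions of `E`. -/
def hamiltonianHO {N : ℕ} (η : ℝ) (f : (Fin N → ℝ) → ℝ) (E : Fin N → ℝ) : ℝ :=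
  -(η / (N : ℝ)) * ∑ i, secondPartial i f E + ((N : ℝ) / η) * (∑ i, E i ^ 2) * f E

/-- The positive nondegenerate diagonal matrices `E`: all `E_i > 0`, and `E_i ≠ E_j` for `i ≠ j`. -/
def positiveNondegenerate (N : ℕ) : Set (Fin N → ℝ) :=
  {E | (∀ i, 0 < E i) ∧ Function.Injective E}

end PhiFour

end

namespace PhiFour

/-! Write ⟨p⟩ for the unnormalised moment ∫ p e^{-S'}, z = ⟨1⟩ and m_i = ⟨N(Φ²)_ii⟩. The action is
linear in E, so differentiating under the integral gives ∂_i Z = -m_i and ∂_i² Z = ⟨(N(Φ²)_ii)²⟩.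
Positivity of E makes every integrand Gaussian-dominated, which gives convergence, smoothness and
vanishing boundary terms.

Two changes of variables close the system. Dilation gives 2 ∑ E_i m_i + ηN ⟨Tr Φ⁴⟩ = N² z
(`moment_dilation`). Unitary conjugation preserves the quartic term and the measure, and gives the
Ward identity m_j - m_i = N² (E_i - E_j) ⟨|(Φ²)_ij|²⟩ (`moment_ward`). Since Tr Φ⁴ = ∑ |(Φ²)_ij|²,
the second identity expresses ⟨Tr Φ⁴⟩ by first and second derivatives of Z (`moment_quartic`);
substituted into the first, it yields a linear second-order equation for Z.

The prefactor of Ψ has logarithmic derivative -(N/η)E_i + ∑_j 1/(E_i - E_j) in E_i. Conjugation by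
it removes the first-order terms, and the remaining potential reduces to (N/η)² ∑ E_i² by two
rational identities, `sum_mul_sum_inv_sub` and `sum_sq_sum_inv_sub`. -/

theorem _root_.Function.HasTemperateGrowth.exists_norm_le {V F : Type*} [NormedAddCommGroup V]
    [NormedSpace ℝ V] [NormedAddCommGroup F] [NormedSpace ℝ F] {f : V → F}
    (hf : f.HasTemperateGrowth) : ∃ (k : ℕ) (C : ℝ), ∀ x, ‖f x‖ ≤ C * (1 + ‖x‖) ^ k := by
  simpa using hf.2 0

theorem _root_.Function.HasTemperateGrowth.exists_norm_fderiv_le {V F : Type*}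
    [NormedAddCommGroup V] [NormedSpace ℝ V] [NormedAddCommGroup F] [NormedSpace ℝ F] {f : V → F}
    (hf : f.HasTemperateGrowth) :
    ∃ (k : ℕ) (C : ℝ), ∀ x, ‖fderiv ℝ f x‖ ≤ C * (1 + ‖x‖) ^ k := by
  simpa [norm_iteratedFDeriv_one] using hf.2 1

/-- Combines (1 + r)² ≤ 2(1 + r²) with y^m / m! ≤ e^y at y = c(1 + r²); the shift by 1 costs the
factor e^c. -/
theorem exp_neg_mul_sq_le {c : ℝ} (hc : 0 < c) (m : ℕ) {r : ℝ} (hr : 0 ≤ r) :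
    (1 + r) ^ (2 * m) * Real.exp (-(c * r ^ 2)) ≤ Real.exp c * (m.factorial * 2 ^ m / c ^ m) := by
  have h1 := Real.pow_div_factorial_le_exp (c * (1 + r ^ 2)) (by positivity) m
  have h2 : (1 + r) ^ (2 * m) ≤ 2 ^ m * (1 + r ^ 2) ^ m := by
    rw [pow_mul, ← mul_pow]
    gcongr
    nlinarith [sq_nonneg (1 - r)]
  have h3 : (1 + r ^ 2) ^ m ≤ (m.factorial / c ^ m) * Real.exp (c * (1 + r ^ 2)) := by
    rw [mul_pow] at h1
    calc (1 + r ^ 2) ^ m = (m.factorial / c ^ m) * (c ^ m * (1 + r ^ 2) ^ m / m.factorial) := by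
          field_simp
      _ ≤ _ := by gcongr
  have h4 : Real.exp (c * (1 + r ^ 2)) * Real.exp (-(c * r ^ 2)) = Real.exp c := by
    rw [← Real.exp_add]; ring_nf
  calc (1 + r) ^ (2 * m) * Real.exp (-(c * r ^ 2))
      ≤ (2 ^ m * ((m.factorial / c ^ m) * Real.exp (c * (1 + r ^ 2)))) *
          Real.exp (-(c * r ^ 2)) := by
        gcongr
        exact h2.trans (by gcongr)
    _ = (2 ^ m * (m.factorial / c ^ m)) *
          (Real.exp (c * (1 + r ^ 2)) * Real.exp (-(c * r ^ 2))) := by ring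
    _ = _ := by rw [h4]; ring

/-! ### Integrability and integration by parts under Gaussian domination -/

section GaussianDecay

open Module

variable {V F : Type*} [NormedAddCommGroup V] [NormedSpace ℝ V] [FiniteDimensional ℝ V]
  [MeasurableSpace V] [BorelSpace V] {μ : Measure V} [μ.IsAddHaarMeasure]
  [NormedAddCommGroup F]

/-- The Gaussian absorbs k + dim V + 1 powers of 1 + ‖x‖, which leaves the integrable function (1 +
‖x‖)^{-(dim V + 1)}. -/
theorem integrable_of_gaussian_bound {f : V → F} (hf : AEStronglyMeasurable f μ) {c C : ℝ} {k : ℕ}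
    (hc : 0 < c) (h : ∀ x, ‖f x‖ ≤ C * (1 + ‖x‖) ^ k * Real.exp (-(c * ‖x‖ ^ 2))) :
    Integrable f μ := by
  have hC : 0 ≤ C := by simpa using (norm_nonneg _).trans (h 0)
  have hint : Integrable (fun x : V => (1 + ‖x‖) ^ (-((finrank ℝ V + 1 : ℕ) : ℝ))) μ :=
    integrable_one_add_norm (by push_cast; linarith)
  set m := k + (finrank ℝ V + 1) with hm
  set K := Real.exp c * (m.factorial * 2 ^ m / c ^ m)
  refine (hint.const_mul (C * K)).mono' hf (Filter.Eventually.of_forall fun x => (h x).trans ?_)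
  have h1 := exp_neg_mul_sq_le hc m (norm_nonneg x)
  have h0 : 1 ≤ 1 + ‖x‖ := by simp
  rw [Real.rpow_neg (by positivity), Real.rpow_natCast, mul_assoc, mul_assoc]
  refine mul_le_mul_of_nonneg_left ?_ hC
  rw [← div_eq_mul_inv, le_div_iff₀ (by positivity)]
  calc (1 + ‖x‖) ^ k * Real.exp (-(c * ‖x‖ ^ 2)) * (1 + ‖x‖) ^ (finrank ℝ V + 1)
      = (1 + ‖x‖) ^ m * Real.exp (-(c * ‖x‖ ^ 2)) := by rw [hm, pow_add]; ring
    _ ≤ (1 + ‖x‖) ^ (2 * m) * Real.exp (-(c * ‖x‖ ^ 2)) := by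
        gcongr
        omega
    _ ≤ K := h1

/-- A product of polynomially bounded functions is integrable against a Gaussian-dominated
exponential weight. -/
theorem integrable_mul_mul_exp_neg {f g S : V → ℝ} (hf : Continuous f) (hg : Continuous g)
    (hS : Continuous S) (hfb : ∃ (k : ℕ) (C : ℝ), ∀ x, ‖f x‖ ≤ C * (1 + ‖x‖) ^ k)
    (hgb : ∃ (k : ℕ) (C : ℝ), ∀ x, ‖g x‖ ≤ C * (1 + ‖x‖) ^ k)
    {c : ℝ} (hc : 0 < c) (hcS : ∀ x, c * ‖x‖ ^ 2 ≤ S x) :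
    Integrable (fun x => f x * g x * Real.exp (-S x)) μ := by
  obtain ⟨k, C, hk⟩ := hfb
  obtain ⟨l, D, hl⟩ := hgb
  refine integrable_of_gaussian_bound (k := k + l) (C := C * D) (by fun_prop) hc fun x => ?_
  rw [norm_mul, norm_mul, Real.norm_of_nonneg (Real.exp_nonneg _)]
  have h1 : ‖f x‖ * ‖g x‖ ≤ C * (1 + ‖x‖) ^ k * (D * (1 + ‖x‖) ^ l) :=
    mul_le_mul (hk x) (hl x) (norm_nonneg _) ((norm_nonneg _).trans (hk x))
  calc _ ≤ C * (1 + ‖x‖) ^ k * (D * (1 + ‖x‖) ^ l) * Real.exp (-(c * ‖x‖ ^ 2)) := by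
        gcongr
        · exact (mul_nonneg (norm_nonneg _) (norm_nonneg _)).trans h1
        · exact hcS x
    _ = _ := by rw [pow_add]; ring

theorem integrable_mul_exp_neg {f S : V → ℝ} (hf : f.HasTemperateGrowth)
    (hS : Continuous S) {c : ℝ} (hc : 0 < c) (hcS : ∀ x, c * ‖x‖ ^ 2 ≤ S x) :
    Integrable (fun x => f x * Real.exp (-S x)) μ := by
  simpa using integrable_mul_mul_exp_neg (μ := μ) (g := fun _ => 1) hf.1.continuous
    continuous_const hS hf.exists_norm_le ⟨0, 1, by simp⟩ hc hcS

/-- Divergence theorem for a linear vector field against an exponential weight. -/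
theorem integral_fderiv_linear_field (L : V →ₗ[ℝ] V) {g S : V → ℝ} (hg : g.HasTemperateGrowth)
    (hS : S.HasTemperateGrowth) {c : ℝ} (hc : 0 < c) (hcS : ∀ x, c * ‖x‖ ^ 2 ≤ S x) :
    ∫ x, (fderiv ℝ g x (L x) - g x * fderiv ℝ S x (L x)) * Real.exp (-S x) ∂μ =
      -(LinearMap.trace ℝ V L * ∫ x, g x * Real.exp (-S x) ∂μ) := by
  have hgd : Differentiable ℝ g := hg.1.differentiable (by simp)
  have hSd : Differentiable ℝ S := hS.1.differentiable (by simp)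
  set b := Module.finBasis ℝ V
  -- The field is L x = ∑ f_a(x) b_a with linear coefficients. Integrating by parts along each b_a
  -- leaves the constant f_a(b_a), and these constants sum to the trace of L, the divergence of the
  -- field.
  have hf : ∀ a, ∃ f : V →L[ℝ] ℝ, ∀ x, f x = b.coord a (L x) := fun a =>
    ⟨LinearMap.toContinuousLinearMap (b.coord a ∘ₗ L), fun x => rfl⟩
  choose f hf using hf
  have hder : ∀ x v, fderiv ℝ (fun x => g x * Real.exp (-S x)) x v =
      (fderiv ℝ g x v - g x * fderiv ℝ S x v) * Real.exp (-S x) := by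
    intro x v
    have := ((hgd x).hasFDerivAt.mul ((hSd x).hasFDerivAt.neg.exp)).fderiv
    simp only [Pi.mul_def] at this
    erw [this]
    simp
    ring
  have hSc : Continuous S := hS.1.continuous
  have hgc : Continuous g := hg.1.continuous
  have hdg : ∀ v, Continuous fun x => fderiv ℝ g x v := fun v =>
    (hg.1.continuous_fderiv (by simp)).clm_apply continuous_const
  have hdS : ∀ v, Continuous fun x => fderiv ℝ S x v := fun v =>
    (hS.1.continuous_fderiv (by simp)).clm_apply continuous_const
  have hbd : ∀ (h : V → ℝ) (_ : h.HasTemperateGrowth) (v : V),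
      ∃ (k : ℕ) (C : ℝ), ∀ x, ‖fderiv ℝ h x v‖ ≤ C * (1 + ‖x‖) ^ k := by
    intro h hh v
    obtain ⟨k, C, hk⟩ := hh.exists_norm_fderiv_le
    refine ⟨k, C * ‖v‖, fun x => ((fderiv ℝ h x).le_opNorm v).trans ?_⟩
    calc _ ≤ C * (1 + ‖x‖) ^ k * ‖v‖ := by gcongr; exact hk x
      _ = _ := by ring
  have hint : ∀ (a) (v : V), Integrable (fun x => f a x *
      ((fderiv ℝ g x v - g x * fderiv ℝ S x v) * Real.exp (-S x))) μ := by
    intro a v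
    have h1 := integrable_mul_mul_exp_neg (μ := μ) (f a).continuous (hdg v) hSc
      (f a).hasTemperateGrowth.exists_norm_le (hbd g hg v) hc hcS
    have hfg : (fun x => f a x * g x).HasTemperateGrowth := by fun_prop
    have h2 := integrable_mul_mul_exp_neg (μ := μ) hfg.1.continuous (hdS v) hSc
      hfg.exists_norm_le (hbd S hS v) hc hcS
    refine (h1.sub h2).congr (Filter.Eventually.of_forall fun x => ?_)
    simp only [Pi.sub_apply]
    ring
  have key : ∀ a, ∫ x, f a x * ((fderiv ℝ g x (b a) - g x * fderiv ℝ S x (b a)) *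
      Real.exp (-S x)) ∂μ = - (b.coord a (L (b a)) * ∫ x, g x * Real.exp (-S x) ∂μ) := by
    intro a
    have := integral_mul_fderiv_eq_neg_fderiv_mul_of_integrable (μ := μ) (v := b a)
      (f := f a) (g := fun x => g x * Real.exp (-S x)) ?_ ?_ ?_ ?_ ?_
    · simp only [hder, ContinuousLinearMap.fderiv] at this
      rw [this, ← hf, integral_const_mul]
    · simp only [ContinuousLinearMap.fderiv]
      exact (integrable_mul_exp_neg hg hSc hc hcS).const_mul _
    · simp only [hder]
      exact hint a (b a)
    · have := integrable_mul_exp_neg (μ := μ) (f := fun x => f a x * g x) (by fun_prop) hSc hc hcS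
      simpa only [mul_assoc] using this
    · exact fun x _ => (f a).differentiableAt
    · exact fun x _ => (hgd x).mul (hSd x).neg.exp
  have hpt : ∀ x, (fderiv ℝ g x (L x) - g x * fderiv ℝ S x (L x)) * Real.exp (-S x) =
      ∑ a, f a x * ((fderiv ℝ g x (b a) - g x * fderiv ℝ S x (b a)) * Real.exp (-S x)) := by
    intro x
    conv_lhs => rw [← b.sum_repr (L x)]
    simp only [map_sum, map_smul, smul_eq_mul, hf, Module.Basis.coord_apply, Finset.mul_sum,
      ← Finset.sum_sub_distrib, Finset.sum_mul]
    refine Finset.sum_congr rfl fun a _ => ?_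
    ring
  simp only [hpt]
  rw [integral_finsetSum _ fun a _ => hint a (b a), Finset.sum_congr rfl fun a _ => key a,
    LinearMap.trace_eq_matrix_trace ℝ b, Finset.sum_neg_distrib, ← Finset.sum_mul]
  congr 2
  simp [Matrix.trace, LinearMap.toMatrix_apply]

end GaussianDecay

/-! ### Smoothness of Laplace-type integrals in their parameters -/

section LaplaceIntegral

open Topology

variable {ι V : Type*} [Fintype ι] [NormedAddCommGroup V] [NormedSpace ℝ V]
  [FiniteDimensional ℝ V] [MeasurableSpace V] [BorelSpace V] {μ : Measure V}
  [μ.IsAddHaarMeasure]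

/-- The Laplace-type integral `∫ p e^{-(∑ E_i Q_i + R)} dμ`. -/
noncomputable def laplaceIntegral {ι V : Type*} [Fintype ι] [MeasurableSpace V] (μ : Measure V) (Q : ι → V → ℝ)
    (R p : V → ℝ) (E : ι → ℝ) : ℝ :=
  ∫ x, p x * Real.exp (-(∑ i, E i * Q i x + R x)) ∂μ

theorem gaussian_lower_bound {ι V : Type*} [Fintype ι] [Norm V]
    {Q : ι → V → ℝ} {R : V → ℝ} (hQ0 : ∀ i x, 0 ≤ Q i x) (hR0 : ∀ x, 0 ≤ R x)
    {c : ℝ} (hcQ : ∀ x, c * ‖x‖ ^ 2 ≤ ∑ i, Q i x) {δ : ℝ} (hδ : 0 < δ) {E : ι → ℝ}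
    (hE : ∀ i, δ ≤ E i) (x : V) : δ * c * ‖x‖ ^ 2 ≤ ∑ i, E i * Q i x + R x := by
  calc δ * c * ‖x‖ ^ 2 = δ * (c * ‖x‖ ^ 2) := by ring
    _ ≤ δ * ∑ i, Q i x := by gcongr; exact hcQ x
    _ = ∑ i, δ * Q i x := Finset.mul_sum _ _ _
    _ ≤ ∑ i, E i * Q i x := Finset.sum_le_sum fun i _ =>
        mul_le_mul_of_nonneg_right (hE i) (hQ0 i x)
    _ ≤ _ := le_add_of_nonneg_right (hR0 x)

theorem exists_pos_lt_forall {ι : Type*} [Finite ι] {E : ι → ℝ} (hE : ∀ i, 0 < E i) :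
    ∃ δ > 0, ∀ i, δ < E i := by
  have h : ∀ᶠ δ in 𝓝[>] (0 : ℝ), ∀ i, δ < E i :=
    Filter.eventually_all.2 fun i => nhdsWithin_le_nhds (eventually_lt_nhds (hE i))
  obtain ⟨δ, h1, h2⟩ := (h.and self_mem_nhdsWithin).exists
  exact ⟨δ, h2, h1⟩

variable {Q : ι → V → ℝ} {R p : V → ℝ} {c : ℝ} {E : ι → ℝ}

theorem hasFDerivAt_laplaceIntegral (hQ : ∀ i, (Q i).HasTemperateGrowth)
    (hR : R.HasTemperateGrowth) (hQ0 : ∀ i x, 0 ≤ Q i x) (hR0 : ∀ x, 0 ≤ R x) (hc : 0 < c)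
    (hcQ : ∀ x, c * ‖x‖ ^ 2 ≤ ∑ i, Q i x) (hp : p.HasTemperateGrowth) (hE : ∀ i, 0 < E i) :
    HasFDerivAt (laplaceIntegral μ Q R p)
      (∑ i, (-laplaceIntegral μ Q R (fun x => p x * Q i x) E) •
        ContinuousLinearMap.proj (R := ℝ) (φ := fun _ : ι => ℝ) i) E := by
  obtain ⟨δ, hδ, hδE⟩ := exists_pos_lt_forall hE
  have hQc : ∀ i, Continuous (Q i) := fun i => (hQ i).1.continuous
  have hRc : Continuous R := hR.1.continuous
  have hpc : Continuous p := hp.1.continuous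
  have hSt : ∀ E : ι → ℝ, (fun x => ∑ i, E i * Q i x + R x).HasTemperateGrowth := by
    intro E
    fun_prop
  -- On this neighbourhood one Gaussian with rate δc dominates all the weights, as dominated
  -- differentiation requires.
  have hs : {E' : ι → ℝ | ∀ i, δ < E' i} ∈ 𝓝 E := by
    have : IsOpen {E' : ι → ℝ | ∀ i, δ < E' i} := by
      simp only [Set.ofPred_forall]
      exact isOpen_iInter_of_finite fun i => isOpen_lt continuous_const (continuous_apply i)
    exact this.mem_nhds hδE
  have hint : ∀ (q : V → ℝ) (_ : q.HasTemperateGrowth),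
      Integrable (fun x => q x * Real.exp (-(∑ i, E i * Q i x + R x))) μ := fun q hq =>
    integrable_mul_exp_neg hq (hSt E).1.continuous (mul_pos hδ hc)
      (gaussian_lower_bound hQ0 hR0 hcQ hδ fun i => (hδE i).le)
  have hpq : ∀ i, (fun x => p x * Q i x).HasTemperateGrowth := fun i => hp.fun_mul (hQ i)
  have hbound : ∀ i, ∃ (k : ℕ) (C : ℝ), ∀ x, ‖p x * Q i x‖ ≤ C * (1 + ‖x‖) ^ k := fun i =>
    (hpq i).exists_norm_le
  choose k C hkC using hbound
  have hC : ∀ i, 0 ≤ C i := fun i => by simpa using (norm_nonneg _).trans (hkC i 0)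
  let F' : (ι → ℝ) → V → ((ι → ℝ) →L[ℝ] ℝ) := fun E x =>
    ∑ i, (-(p x * Q i x * Real.exp (-(∑ j, E j * Q j x + R x)))) •
        ContinuousLinearMap.proj (R := ℝ) (φ := fun _ : ι => ℝ) i
  have hmain := hasFDerivAt_integral_of_dominated_of_fderiv_le (μ := μ) (x₀ := E)
    (F := fun E x => p x * Real.exp (-(∑ i, E i * Q i x + R x))) (F' := F')
    (bound := fun x => ∑ i, C i * (1 + ‖x‖) ^ k i * Real.exp (-(δ * c * ‖x‖ ^ 2)) *
      ‖ContinuousLinearMap.proj (R := ℝ) (φ := fun _ : ι => ℝ) i‖)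
    hs ?_ (hint p hp) ?_ ?_ ?_ ?_
  · refine HasFDerivAt.congr_fderiv hmain ?_
    simp only [F']
    have hneg : ∀ i, Integrable
        (fun x => -(p x * Q i x * Real.exp (-(∑ j, E j * Q j x + R x)))) μ := fun i =>
      (hint _ (hpq i)).neg
    rw [integral_finsetSum _ fun i _ => (hneg i).smul_const _]
    refine Finset.sum_congr rfl fun i _ => ?_
    rw [integral_smul_const, integral_neg]
    rfl
  · refine Filter.Eventually.of_forall fun E' => Continuous.aestronglyMeasurable ?_
    have := (hSt E').1.continuous
    fun_prop
  · refine Continuous.aestronglyMeasurable ?_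
    simp only [F']
    fun_prop
  · refine Filter.Eventually.of_forall fun x E' hE' => ?_
    refine (norm_sum_le _ _).trans (Finset.sum_le_sum fun i _ => ?_)
    rw [norm_smul, norm_neg, norm_mul, Real.norm_of_nonneg (Real.exp_nonneg _)]
    have h1 := gaussian_lower_bound hQ0 hR0 hcQ hδ (fun i => (hE' i).le) x
    gcongr
    · exact mul_nonneg (hC i) (by positivity)
    · exact hkC i x
  · refine integrable_finsetSum _ fun i _ => Integrable.mul_const ?_ _
    refine integrable_of_gaussian_bound (k := k i) (C := C i) (c := δ * c) ?_ (mul_pos hδ hc) ?_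
    · exact Continuous.aestronglyMeasurable (by fun_prop)
    · intro x
      rw [Real.norm_of_nonneg]
      exact mul_nonneg (mul_nonneg (hC i) (by positivity)) (Real.exp_nonneg _)
  · refine Filter.Eventually.of_forall fun x E' _ => ?_
    have h1 : HasFDerivAt (fun E : ι → ℝ => ∑ i, E i * Q i x + R x)
        (∑ i, Q i x • ContinuousLinearMap.proj (R := ℝ) (φ := fun _ : ι => ℝ) i) E' := by
      refine HasFDerivAt.add_const _ (HasFDerivAt.fun_sum fun i _ => ?_)
      exact (hasFDerivAt_apply i E').mul_const (Q i x)
    refine HasFDerivAt.congr_fderiv ((h1.neg.exp).const_mul (p x)) ?_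
    simp only [F', smul_neg, Finset.smul_sum, smul_smul, ← Finset.sum_neg_distrib]
    refine Finset.sum_congr rfl fun i _ => ?_
    rw [← neg_smul]
    congr 1
    simp only [Pi.neg_apply]
    ring

theorem isOpen_forall_pos {ι : Type*} [Finite ι] : IsOpen {E : ι → ℝ | ∀ i, 0 < E i} := by
  simp only [Set.ofPred_forall]
  exact isOpen_iInter_of_finite fun i => isOpen_lt continuous_const (continuous_apply i)

/-- The partial derivatives are again Laplace integrals, with p replaced by -p Q_i, so the induction
on n must run over all p of temperate growth. -/
theorem contDiffOn_laplaceIntegral (hQ : ∀ i, (Q i).HasTemperateGrowth)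
    (hR : R.HasTemperateGrowth) (hQ0 : ∀ i x, 0 ≤ Q i x) (hR0 : ∀ x, 0 ≤ R x) (hc : 0 < c)
    (hcQ : ∀ x, c * ‖x‖ ^ 2 ≤ ∑ i, Q i x) (hp : p.HasTemperateGrowth) (n : ℕ) :
    ContDiffOn ℝ n (laplaceIntegral μ Q R p) {E : ι → ℝ | ∀ i, 0 < E i} := by
  induction n generalizing p with
  | zero =>
    rw [Nat.cast_zero, contDiffOn_zero]
    exact fun E hE =>
      (hasFDerivAt_laplaceIntegral hQ hR hQ0 hR0 hc hcQ hp hE).continuousAt.continuousWithinAt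
  | succ n ih =>
    have hd := fun (E : ι → ℝ) (hE : ∀ i, 0 < E i) =>
      hasFDerivAt_laplaceIntegral (μ := μ) hQ hR hQ0 hR0 hc hcQ hp hE
    rw [Nat.cast_add, Nat.cast_one, contDiffOn_succ_iff_fderiv_of_isOpen isOpen_forall_pos]
    refine ⟨fun E hE => (hd E hE).differentiableAt.differentiableWithinAt, by simp, ?_⟩
    refine ContDiffOn.congr (f := fun E => ∑ i, (-laplaceIntegral μ Q R (fun x => p x * Q i x) E) •
        ContinuousLinearMap.proj (R := ℝ) (φ := fun _ : ι => ℝ) i) ?_ fun E hE => (hd E hE).fderiv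
    exact ContDiffOn.sum fun i _ => (ih (hp.fun_mul (hQ i))).neg.smul contDiffOn_const

theorem hasDerivAt_laplaceIntegral_update [DecidableEq ι] (hQ : ∀ i, (Q i).HasTemperateGrowth)
    (hR : R.HasTemperateGrowth) (hQ0 : ∀ i x, 0 ≤ Q i x) (hR0 : ∀ x, 0 ≤ R x) (hc : 0 < c)
    (hcQ : ∀ x, c * ‖x‖ ^ 2 ≤ ∑ i, Q i x) (hp : p.HasTemperateGrowth) (hE : ∀ i, 0 < E i)
    (i : ι) {t : ℝ} (ht : 0 < t) :
    HasDerivAt (fun t => laplaceIntegral μ Q R p (Function.update E i t))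
      (-laplaceIntegral μ Q R (fun x => p x * Q i x) (Function.update E i t)) t := by
  have hE' : ∀ j, 0 < Function.update E i t j := by
    intro j
    rcases eq_or_ne j i with rfl | h
    · simpa using ht
    · simpa [h] using hE j
  have := (hasFDerivAt_laplaceIntegral (μ := μ) hQ hR hQ0 hR0 hc hcQ hp hE').comp_hasDerivAt t
    (hasDerivAt_update E i t)
  simpa [Function.comp_def, Pi.single_apply] using this

end LaplaceIntegral

/-! ### Hermitian matrices in real coordinates, the action and conjugation fields -/

noncomputable section MatrixCoordinates

open Matrix ComplexConjugate

variable {N : ℕ}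

/-- `toMatrix` as a real linear map. -/
def toMatrixLin (N : ℕ) : HermCoord N →ₗ[ℝ] Matrix (Fin N) (Fin N) ℂ where
  toFun := toMatrix
  map_add' x y := by
    ext i j
    simp only [toMatrix, Matrix.of_apply, Matrix.add_apply]
    split_ifs <;> simp [Complex.ext_iff, add_comm]
  map_smul' r x := by
    ext i j
    simp only [toMatrix, Matrix.of_apply, Matrix.smul_apply]
    split_ifs <;> simp [Complex.ext_iff]

/-- The real coordinates read off from the diagonal and the upper triangle of a matrix. -/
def ofMatrix (N : ℕ) : Matrix (Fin N) (Fin N) ℂ →ₗ[ℝ] HermCoord N where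
  toFun A := (fun i => (A i i).re, fun p => (A p.1.1 p.1.2).re, fun p => (A p.1.1 p.1.2).im)
  map_add' A B := by ext <;> simp
  map_smul' r A := by ext <;> simp

theorem toMatrix_ofMatrix {A : Matrix (Fin N) (Fin N) ℂ} (hA : A.IsHermitian) :
    toMatrix (ofMatrix N A) = A := by
  ext i j
  have h := hA.apply i j
  simp only [toMatrix, ofMatrix, Matrix.of_apply, LinearMap.coe_mk, AddHom.coe_mk]
  split_ifs with h1 h2
  · rfl
  · rw [← h]; simp [Complex.ext_iff]
  · obtain rfl : i = j := le_antisymm (not_lt.1 h2) (not_lt.1 h1)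
    exact Complex.conj_eq_iff_re.1 h

/-- The entry `Φ_ij` as a continuous linear function of the real coordinates. -/
def entry (i j : Fin N) : HermCoord N →L[ℝ] ℂ :=
  LinearMap.toContinuousLinearMap (Matrix.entryLinearMap ℝ ℂ i j ∘ₗ toMatrixLin N)

theorem entry_apply (i j : Fin N) (x : HermCoord N) : entry i j x = toMatrix x i j := rfl

theorem sq_apply_eq (i j : Fin N) (x : HermCoord N) :
    (toMatrix x ^ 2) i j = ∑ k, entry i k x * entry k j x := by
  simp [pow_two, Matrix.mul_apply, entry_apply]

/-- The derivative of the entries of `Φ²`. -/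
def sqDeriv (i j : Fin N) (x : HermCoord N) : HermCoord N →L[ℝ] ℂ :=
  ∑ k, (entry i k x • entry k j + entry k j x • entry i k)

theorem hasFDerivAt_sq_apply (i j : Fin N) (x : HermCoord N) :
    HasFDerivAt (fun x => (toMatrix x ^ 2) i j) (sqDeriv i j x) x := by
  simp only [sq_apply_eq]
  exact HasFDerivAt.fun_sum fun k _ => (entry i k).hasFDerivAt.mul (entry k j).hasFDerivAt

theorem sqDeriv_apply (i j : Fin N) (x v : HermCoord N) :
    sqDeriv i j x v = (toMatrix v * toMatrix x + toMatrix x * toMatrix v) i j := by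
  simp only [sqDeriv, _root_.sum_apply, _root_.add_apply,
    _root_.smul_apply, smul_eq_mul, entry_apply, Matrix.add_apply, Matrix.mul_apply,
    ← Finset.sum_add_distrib]
  exact Finset.sum_congr rfl fun k _ => by ring

theorem hasTemperateGrowth_sq_apply (i j : Fin N) :
    (fun x : HermCoord N => (toMatrix x ^ 2) i j).HasTemperateGrowth := by
  simp only [sq_apply_eq]
  fun_prop

theorem hasTemperateGrowth_re {V : Type*} [NormedAddCommGroup V] [NormedSpace ℝ V] {f : V → ℂ}
    (hf : f.HasTemperateGrowth) : (fun x => (f x).re).HasTemperateGrowth :=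
  Complex.reCLM.hasTemperateGrowth.comp hf

theorem hasTemperateGrowth_im {V : Type*} [NormedAddCommGroup V] [NormedSpace ℝ V] {f : V → ℂ}
    (hf : f.HasTemperateGrowth) : (fun x => (f x).im).HasTemperateGrowth :=
  Complex.imCLM.hasTemperateGrowth.comp hf

theorem hasTemperateGrowth_normSq {V : Type*} [NormedAddCommGroup V] [NormedSpace ℝ V] {f : V → ℂ}
    (hf : f.HasTemperateGrowth) : (fun x => Complex.normSq (f x)).HasTemperateGrowth := by
  simp only [Complex.normSq_apply]
  exact ((hasTemperateGrowth_re hf).fun_mul (hasTemperateGrowth_re hf)).fun_add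
    ((hasTemperateGrowth_im hf).fun_mul (hasTemperateGrowth_im hf))

/-- The function `N (Φ²)_ii`. -/
def diagSq (i : Fin N) (x : HermCoord N) : ℝ := N * ((toMatrix x ^ 2) i i).re

/-- The function `Tr Φ⁴`. -/
def quartic (x : HermCoord N) : ℝ := ∑ i, ∑ j, Complex.normSq ((toMatrix x ^ 2) i j)

theorem hasTemperateGrowth_diagSq (i : Fin N) : (diagSq i).HasTemperateGrowth :=
  (Function.HasTemperateGrowth.const _).fun_mul
    (hasTemperateGrowth_re (hasTemperateGrowth_sq_apply i i))

theorem hasTemperateGrowth_quartic : (quartic (N := N)).HasTemperateGrowth :=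
  Function.HasTemperateGrowth.sum fun i _ => Function.HasTemperateGrowth.sum fun j _ =>
    hasTemperateGrowth_normSq (hasTemperateGrowth_sq_apply i j)

theorem toMatrix_sq_conj (x : HermCoord N) (i j : Fin N) :
    conj ((toMatrix x ^ 2) i j) = (toMatrix x ^ 2) j i :=
  ((toMatrix_isHermitian x).pow 2).apply j i

theorem diag_sq_re (i : Fin N) (x : HermCoord N) :
    ((toMatrix x ^ 2) i i).re = ∑ k, Complex.normSq (toMatrix x i k) := by
  rw [sq_apply_eq, Complex.re_sum]
  refine Finset.sum_congr rfl fun k _ => ?_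
  rw [entry_apply, entry_apply, ← (toMatrix_isHermitian x).apply k i]
  simp [Complex.mul_re, Complex.normSq_apply]

theorem diagSq_nonneg (i : Fin N) (x : HermCoord N) : 0 ≤ diagSq i x := by
  rw [diagSq, diag_sq_re]
  exact mul_nonneg (Nat.cast_nonneg _) (Finset.sum_nonneg fun k _ => Complex.normSq_nonneg _)

theorem quartic_nonneg (x : HermCoord N) : 0 ≤ quartic x :=
  Finset.sum_nonneg fun _ _ => Finset.sum_nonneg fun _ _ => Complex.normSq_nonneg _

/-- The right side is N times the squared Frobenius norm, while ‖x‖ is the sup norm, so each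
coordinate is bounded by a single matrix entry. This is the coercivity behind all Gaussian bounds.
-/
theorem mul_norm_sq_le_sum_diagSq (x : HermCoord N) : (N : ℝ) * ‖x‖ ^ 2 ≤ ∑ i, diagSq i x := by
  simp only [diagSq, diag_sq_re, ← Finset.mul_sum]
  refine mul_le_mul_of_nonneg_left ?_ (Nat.cast_nonneg _)
  set s := ∑ i, ∑ k, Complex.normSq (toMatrix x i k) with hs
  have hle : ∀ i j, Complex.normSq (toMatrix x i j) ≤ s := fun i j =>
    (Finset.single_le_sum (f := fun k => Complex.normSq (toMatrix x i k))
      (fun k _ => Complex.normSq_nonneg _) (Finset.mem_univ j)).trans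
    (Finset.single_le_sum (f := fun i => ∑ k, Complex.normSq (toMatrix x i k))
      (fun i _ => Finset.sum_nonneg fun k _ => Complex.normSq_nonneg _) (Finset.mem_univ i))
  have h0 : 0 ≤ s := Finset.sum_nonneg fun i _ => Finset.sum_nonneg fun k _ =>
    Complex.normSq_nonneg _
  have hU : ∀ p : UpperPair N, toMatrix x p.1.1 p.1.2 = ⟨x.2.1 p, x.2.2 p⟩ := fun p => by
    simp [toMatrix, p.2]
  have h : ‖x‖ ≤ √s := by
    refine norm_prod_le_iff.2 ⟨?_, norm_prod_le_iff.2 ⟨?_, ?_⟩⟩ <;>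
      refine (pi_norm_le_iff_of_nonneg (Real.sqrt_nonneg _)).2 fun p => Real.abs_le_sqrt ?_
    · refine le_trans ?_ (hle p p)
      simp [toMatrix, Complex.normSq_apply, pow_two]
    · refine le_trans ?_ (hle p.1.1 p.1.2)
      rw [hU, Complex.normSq_apply]
      nlinarith [sq_nonneg (x.2.2 p)]
    · refine le_trans ?_ (hle p.1.1 p.1.2)
      rw [hU, Complex.normSq_apply]
      nlinarith [sq_nonneg (x.2.1 p)]
  calc ‖x‖ ^ 2 ≤ √s ^ 2 := by gcongr
    _ = s := Real.sq_sqrt h0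

theorem trace_sq_mul_sq_re (x : HermCoord N) : ((toMatrix x ^ 4).trace).re = quartic x := by
  rw [show (4 : ℕ) = 2 + 2 from rfl, pow_add, Matrix.trace, Complex.re_sum]
  refine Finset.sum_congr rfl fun i _ => ?_
  rw [Matrix.diag_apply, Matrix.mul_apply, Complex.re_sum]
  refine Finset.sum_congr rfl fun j _ => ?_
  rw [← toMatrix_sq_conj x i j, Complex.mul_conj, Complex.ofReal_re]

theorem action_toMatrix (η : ℝ) (E : Fin N → ℝ) (x : HermCoord N) :
    action η E (toMatrix x) = ∑ i, E i * diagSq i x + N * (η / 4) * quartic x := by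
  rw [action, actionC, Matrix.trace_add, Matrix.trace_smul, ← trace_sq_mul_sq_re]
  simp only [Matrix.trace, Matrix.diag_apply, Matrix.diagonal_mul, diagSq]
  simp only [smul_eq_mul, mul_add, Complex.add_re, ← Complex.ofReal_natCast, Complex.re_ofReal_mul,
    Complex.re_sum, Finset.mul_sum]
  congr 1
  · exact Finset.sum_congr rfl fun i _ => by ring
  · exact Finset.sum_congr rfl fun i _ => by ring

/-- The action as a sum of its `E`-dependent and `E`-independent parts. -/
def splitAction (η : ℝ) (E : Fin N → ℝ) (x : HermCoord N) : ℝ :=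
  ∑ i, E i * diagSq i x + N * (η / 4) * quartic x

theorem hasTemperateGrowth_splitAction (η : ℝ) (E : Fin N → ℝ) :
    (splitAction η E).HasTemperateGrowth :=
  (Function.HasTemperateGrowth.sum fun i _ => (Function.HasTemperateGrowth.const _).fun_mul
    (hasTemperateGrowth_diagSq i)).fun_add
    ((Function.HasTemperateGrowth.const _).fun_mul hasTemperateGrowth_quartic)

theorem hasFDerivAt_normSq {V : Type*} [NormedAddCommGroup V] [NormedSpace ℝ V] {f : V → ℂ}
    {f' : V →L[ℝ] ℂ} {x : V} (hf : HasFDerivAt f f' x) :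
    HasFDerivAt (fun x => Complex.normSq (f x))
      ((2 : ℝ) • Complex.reCLM ∘L (conj (f x) • f')) x := by
  have hre := Complex.reCLM.hasFDerivAt.comp x hf
  have him := Complex.imCLM.hasFDerivAt.comp x hf
  simp only [Complex.normSq_apply]
  refine ((hre.mul hre).add (him.mul him)).congr_fderiv ?_
  ext v
  simp
  ring

/-- Both parts of the action depend on Φ only through Φ², so the direction v enters only through vΦ
+ Φv, the derivative of Φ². -/
theorem fderiv_splitAction (η : ℝ) (E : Fin N → ℝ) (x v : HermCoord N) :
    fderiv ℝ (splitAction η E) x v =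
      N * ((diagonal (fun i => (E i : ℂ)) * (toMatrix v * toMatrix x + toMatrix x * toMatrix v)
        ).trace.re + η / 2 *
        (toMatrix x ^ 2 * (toMatrix v * toMatrix x + toMatrix x * toMatrix v)).trace.re) := by
  have h1 : ∀ i, HasFDerivAt (diagSq i) ((N : ℝ) • Complex.reCLM ∘L sqDeriv i i x) x := fun i =>
    (Complex.reCLM.hasFDerivAt.comp x (hasFDerivAt_sq_apply i i x)).const_mul (N : ℝ)
  have h2 : HasFDerivAt (quartic (N := N)) (∑ i, ∑ j,
      (2 : ℝ) • Complex.reCLM ∘L (conj ((toMatrix x ^ 2) i j) • sqDeriv i j x)) x :=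
    HasFDerivAt.fun_sum fun i _ => HasFDerivAt.fun_sum fun j _ =>
      hasFDerivAt_normSq (hasFDerivAt_sq_apply i j x)
  have h3 : HasFDerivAt (splitAction η E) _ x :=
    (HasFDerivAt.fun_sum (u := Finset.univ) fun i _ => (h1 i).const_mul (E i)).add
      (h2.const_mul ((N : ℝ) * (η / 4)))
  rw [h3.fderiv]
  set D := toMatrix v * toMatrix x + toMatrix x * toMatrix v with hD
  have h4 : (toMatrix x ^ 2 * D).trace.re = ∑ i, ∑ j, (conj ((toMatrix x ^ 2) i j) * D i j).re := by
    simp only [toMatrix_sq_conj]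
    rw [Finset.sum_comm]
    simp only [Matrix.trace, Matrix.diag_apply, Matrix.mul_apply, Complex.re_sum]
  have h5 : (diagonal (fun i => (E i : ℂ)) * D).trace.re = ∑ i, E i * (D i i).re := by
    simp [Matrix.trace, Matrix.diagonal_mul]
  rw [h4, h5]
  simp only [_root_.add_apply, _root_.smul_apply,
    _root_.sum_apply, ContinuousLinearMap.comp_apply, Complex.reCLM_apply,
    sqDeriv_apply, ← hD, smul_eq_mul, ← Finset.mul_sum]
  rw [mul_add]
  congr 1
  · rw [Finset.mul_sum]
    exact Finset.sum_congr rfl fun i _ => by ring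
  · simp only [Finset.mul_sum]
    exact Finset.sum_congr rfl fun i _ => Finset.sum_congr rfl fun j _ => by ring

theorem card_upperPair (N : ℕ) : 2 * Fintype.card (UpperPair N) + N = N ^ 2 := by
  have h1 : Fintype.card (UpperPair N) = ∑ i : Fin N, ∑ j : Fin N, if i < j then 1 else 0 := by
    rw [Fintype.card_subtype, Finset.card_filter, Fintype.sum_prod_type]
  have h2 : Fintype.card (UpperPair N) = ∑ i : Fin N, ∑ j : Fin N, if j < i then 1 else 0 := by
    rw [h1, Finset.sum_comm]
  have h3 : N = ∑ i : Fin N, ∑ j : Fin N, if i = j then 1 else 0 := by simp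
  have h4 : N ^ 2 = ∑ i : Fin N, ∑ j : Fin N, 1 := by simp [pow_two]
  suffices h : ((∑ i : Fin N, ∑ j : Fin N, if i < j then 1 else 0) +
      ∑ i : Fin N, ∑ j : Fin N, if j < i then 1 else 0) +
      (∑ i : Fin N, ∑ j : Fin N, if i = j then 1 else 0) = ∑ i : Fin N, ∑ j : Fin N, 1 by omega
  simp only [← Finset.sum_add_distrib]
  refine Finset.sum_congr rfl fun i _ => Finset.sum_congr rfl fun j _ => ?_
  rcases lt_trichotomy i j with h | h | h
  · simp [h, h.not_gt, h.ne]
  · simp [h]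
  · simp [h, h.not_gt, h.ne']

theorem finrank_hermCoord (N : ℕ) : Module.finrank ℝ (HermCoord N) = N ^ 2 := by
  rw [← card_upperPair]
  simp [HermCoord, Module.finrank_prod]
  ring

/-- The infinitesimal conjugation `Φ ↦ [B, Φ]` in real coordinates. -/
def adLin (B : Matrix (Fin N) (Fin N) ℂ) : HermCoord N →ₗ[ℝ] HermCoord N where
  toFun x := ofMatrix N (B * toMatrix x - toMatrix x * B)
  map_add' x y := by
    rw [show toMatrix (x + y) = toMatrix x + toMatrix y from (toMatrixLin N).map_add x y,
      ← map_add]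
    congr 1
    noncomm_ring
  map_smul' r x := by
    rw [show toMatrix (r • x) = r • toMatrix x from (toMatrixLin N).map_smul r x,
      RingHom.id_apply, ← map_smul]
    simp [smul_sub]

theorem adLin_apply (B : Matrix (Fin N) (Fin N) ℂ) (x : HermCoord N) :
    adLin B x = ofMatrix N (B * toMatrix x - toMatrix x * B) := rfl

theorem toMatrix_adLin {B : Matrix (Fin N) (Fin N) ℂ} (hB : Bᴴ = -B) (x : HermCoord N) :
    toMatrix (adLin B x) = B * toMatrix x - toMatrix x * B := by
  refine toMatrix_ofMatrix ?_
  rw [Matrix.IsHermitian, Matrix.conjTranspose_sub, Matrix.conjTranspose_mul,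
    Matrix.conjTranspose_mul, hB, (toMatrix_isHermitian x).eq]
  noncomm_ring

/-- By the Jacobi identity `adLin` sends this commutator to a commutator of endomorphisms, which is
traceless. Skew-Hermiticity keeps [X, Φ] and [Y, Φ] Hermitian, so passing through coordinates loses
nothing. -/
theorem trace_adLin_commutator {X Y : Matrix (Fin N) (Fin N) ℂ} (hX : Xᴴ = -X) (hY : Yᴴ = -Y) :
    LinearMap.trace ℝ _ (adLin (X * Y - Y * X)) = 0 := by
  have : adLin (X * Y - Y * X) = adLin X * adLin Y - adLin Y * adLin X := by
    refine LinearMap.ext fun x => ?_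
    simp only [LinearMap.sub_apply, Module.End.mul_apply]
    rw [adLin_apply, adLin_apply X, adLin_apply Y (adLin X x), toMatrix_adLin hX, toMatrix_adLin hY,
      ← map_sub]
    congr 1
    noncomm_ring
  rw [this, map_sub, LinearMap.trace_mul_comm, sub_self]

/-- The skew-Hermitian matrix `z e_ij - z̄ e_ji`. -/
def skewUnit (i j : Fin N) (z : ℂ) : Matrix (Fin N) (Fin N) ℂ :=
  Matrix.single i j z - Matrix.single j i (conj z)

theorem skewUnit_conjTranspose (i j : Fin N) (z : ℂ) : (skewUnit i j z)ᴴ = -skewUnit i j z := by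
  simp [skewUnit, Matrix.conjTranspose_sub, Matrix.conjTranspose_single]

/-- The conjugation field is divergence-free because its generator is itself a commutator, of √-1
e_ii with the skew unit of parameter -√-1 z. -/
theorem trace_adLin_skewUnit {i j : Fin N} (hij : i ≠ j) (z : ℂ) :
    LinearMap.trace ℝ _ (adLin (skewUnit i j z)) = 0 := by
  have hX : (Matrix.single i i Complex.I)ᴴ = -Matrix.single i i Complex.I := by
    rw [Matrix.conjTranspose_single, Complex.star_def, Complex.conj_I]
    ext a b
    rw [Matrix.neg_apply, Matrix.single_apply, Matrix.single_apply]
    split_ifs <;> simp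
  rw [← trace_adLin_commutator hX (skewUnit_conjTranspose i j (-Complex.I * z))]
  congr 2
  have h1 : Complex.I * (-Complex.I * z) = z := by
    rw [← mul_assoc, mul_neg, Complex.I_mul_I, neg_neg, one_mul]
  have h2 : conj (-Complex.I * z) * Complex.I = -conj z := by
    rw [map_mul, map_neg, Complex.conj_I, neg_neg, mul_right_comm, Complex.I_mul_I, neg_one_mul]
  rw [skewUnit, skewUnit, mul_sub, sub_mul, Matrix.single_mul_single_same,
    Matrix.single_mul_single_of_ne _ _ _ _ hij, Matrix.single_mul_single_of_ne _ _ _ _ hij.symm,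
    Matrix.single_mul_single_same, h1, h2]
  ext a b
  simp only [Matrix.sub_apply, Matrix.zero_apply, Matrix.single_apply]
  split_ifs <;> ring

end MatrixCoordinates

/-! ### Moments, the dilation equation and the Ward identities -/

noncomputable section SchwingerDyson

open Matrix ComplexConjugate

variable {N : ℕ}

instance isAddHaarMeasure_volume_hermCoord :
    (volume : Measure (HermCoord N)).IsAddHaarMeasure :=
  have : ((volume : Measure (UpperPair N → ℝ)).prod
      (volume : Measure (UpperPair N → ℝ))).IsAddHaarMeasure :=
    Measure.prod.instIsAddHaarMeasure _ _
  Measure.prod.instIsAddHaarMeasure (volume : Measure (Fin N → ℝ)) _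

/-- The unnormalised moment `∫ p e^{-S'}`. -/
def moment (η : ℝ) (p : HermCoord N → ℝ) (E : Fin N → ℝ) : ℝ :=
  laplaceIntegral volume diagSq (fun x => N * (η / 4) * quartic x) p E

theorem moment_eq (η : ℝ) (p : HermCoord N → ℝ) (E : Fin N → ℝ) :
    moment η p E = ∫ x, p x * Real.exp (-splitAction η E x) := rfl

theorem Z_eq_moment (η : ℝ) (E : Fin N → ℝ) : Z η E = moment η (fun _ => 1) E := by
  simp only [Z, weight, action_toMatrix, moment_eq, one_mul, splitAction]

variable {η : ℝ} {E : Fin N → ℝ}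

theorem exists_splitAction_lower_bound (hN : 1 ≤ N) (hη : 0 < η) (hE : ∀ i, 0 < E i) :
    ∃ c > 0, ∀ x, c * ‖x‖ ^ 2 ≤ splitAction η E x := by
  obtain ⟨δ, hδ, hδE⟩ := exists_pos_lt_forall hE
  have hN' : (0 : ℝ) < N := by exact_mod_cast hN
  exact ⟨δ * N, mul_pos hδ hN', gaussian_lower_bound diagSq_nonneg
    (fun x => mul_nonneg (by positivity) (quartic_nonneg x)) mul_norm_sq_le_sum_diagSq hδ
    fun i => (hδE i).le⟩

theorem integrable_mul_exp_neg_splitAction (hN : 1 ≤ N) (hη : 0 < η) (hE : ∀ i, 0 < E i)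
    {p : HermCoord N → ℝ} (hp : p.HasTemperateGrowth) :
    Integrable fun x => p x * Real.exp (-splitAction η E x) := by
  obtain ⟨c, hc, hcS⟩ := exists_splitAction_lower_bound hN hη hE
  exact integrable_mul_exp_neg hp (hasTemperateGrowth_splitAction η E).1.continuous hc hcS

theorem integrable_weight (hN : 1 ≤ N) (hη : 0 < η) (hE : ∀ i, 0 < E i) :
    Integrable fun x : HermCoord N => weight η E x := by
  simpa [weight, action_toMatrix, splitAction] using
    integrable_mul_exp_neg_splitAction hN hη hE (p := fun _ => 1) (by fun_prop)

/-- The Schwinger–Dyson equation of the dilation `Φ ↦ sΦ`. -/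
theorem moment_dilation (hN : 1 ≤ N) (hη : 0 < η) (hE : ∀ i, 0 < E i) :
    2 * ∑ i, E i * moment η (diagSq i) E + η * N * moment η quartic E =
      N ^ 2 * moment η (fun _ => 1) E := by
  obtain ⟨c, hc, hcS⟩ := exists_splitAction_lower_bound hN hη hE
  have h := integral_fderiv_linear_field (μ := (volume : Measure (HermCoord N))) LinearMap.id
    (g := fun _ => 1) (by fun_prop) (hasTemperateGrowth_splitAction η E) hc hcS
  -- Euler's identity: degree 2 gives the factor 2, and degree 4 turns Nη/4 into ηN.
  have h1 : ∀ x : HermCoord N, fderiv ℝ (splitAction η E) x x =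
      2 * (∑ i, E i * diagSq i x) + η * N * quartic x := by
    intro x
    rw [fderiv_splitAction, ← trace_sq_mul_sq_re, ← two_mul, ← pow_two,
      show (4 : ℕ) = 2 + 2 from rfl, pow_add]
    have h2 : (diagonal (fun i => (E i : ℂ)) * (2 * toMatrix x ^ 2)).trace.re =
        2 * ∑ i, E i * ((toMatrix x ^ 2) i i).re := by
      rw [two_mul, mul_add, Matrix.trace_add, Complex.add_re, ← two_mul]
      simp [Matrix.trace, Matrix.diagonal_mul]
    have h3 : (toMatrix x ^ 2 * (2 * toMatrix x ^ 2)).trace.re =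
        2 * (toMatrix x ^ 2 * toMatrix x ^ 2).trace.re := by
      rw [two_mul, mul_add, Matrix.trace_add, Complex.add_re, ← two_mul]
    rw [h2, h3]
    simp only [diagSq, Finset.mul_sum, mul_add]
    congr 1
    · exact Finset.sum_congr rfl fun i _ => by ring
    · ring
  simp only [LinearMap.id_apply, h1, LinearMap.trace_id, finrank_hermCoord] at h
  have hi : ∀ i, Integrable fun x => diagSq i x * Real.exp (-splitAction η E x) := fun i =>
    integrable_mul_exp_neg_splitAction hN hη hE (hasTemperateGrowth_diagSq i)
  have hq : Integrable fun x => quartic x * Real.exp (-splitAction η E x) :=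
    integrable_mul_exp_neg_splitAction hN hη hE hasTemperateGrowth_quartic
  have hpt : ∀ x : HermCoord N,
      (fderiv ℝ (fun _ : HermCoord N => (1 : ℝ)) x x - 1 * (2 * (∑ i, E i * diagSq i x) +
        η * N * quartic x)) * Real.exp (-splitAction η E x) =
      -(∑ i, 2 * E i * (diagSq i x * Real.exp (-splitAction η E x)) +
        η * N * (quartic x * Real.exp (-splitAction η E x))) := by
    intro x
    rw [show ∑ i, 2 * E i * (diagSq i x * Real.exp (-splitAction η E x)) =
      2 * (∑ i, E i * diagSq i x) * Real.exp (-splitAction η E x) by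
        rw [Finset.mul_sum, Finset.sum_mul]
        exact Finset.sum_congr rfl fun i _ => by ring]
    simp
    ring
  simp only [hpt] at h
  rw [← moment_eq η (fun _ => 1), integral_neg, neg_inj, integral_add (integrable_finsetSum _ fun i _ => (hi i).const_mul _)
    (hq.const_mul _), integral_finsetSum _ fun i _ => (hi i).const_mul _] at h
  simp only [integral_const_mul, ← moment_eq] at h
  rw [Finset.mul_sum]
  simp only [← mul_assoc] at h ⊢
  push_cast at h
  exact h

theorem sq_adLin {B : Matrix (Fin N) (Fin N) ℂ} (hB : Bᴴ = -B) (x : HermCoord N) :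
    toMatrix (adLin B x) * toMatrix x + toMatrix x * toMatrix (adLin B x) =
      B * toMatrix x ^ 2 - toMatrix x ^ 2 * B := by
  rw [toMatrix_adLin hB]
  noncomm_ring

theorem skewUnit_commutator_apply {i j : Fin N} (hij : i ≠ j) (z : ℂ)
    (M : Matrix (Fin N) (Fin N) ℂ) :
    (skewUnit i j z * M - M * skewUnit i j z) i j = z * (M j j - M i i) := by
  simp [skewUnit, Matrix.sub_mul, Matrix.mul_sub, hij, hij.symm]
  ring

theorem trace_diagonal_mul_skewUnit_commutator (i j : Fin N) (z : ℂ) (E : Fin N → ℂ)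
    (M : Matrix (Fin N) (Fin N) ℂ) :
    (diagonal E * (skewUnit i j z * M - M * skewUnit i j z)).trace =
      (E i - E j) * (z * M j i + conj z * M i j) := by
  have h : ∀ a b (w : ℂ), (diagonal E * (Matrix.single a b w * M)).trace = E a * (w * M b a) ∧
      (diagonal E * (M * Matrix.single a b w)).trace = E b * (M b a * w) := by
    intro a b w
    constructor
    · rw [← mul_assoc, Matrix.trace_mul_comm, ← mul_assoc, Matrix.trace_mul_single,
        Matrix.mul_diagonal]
      simp
      ring
    · rw [← mul_assoc, Matrix.trace_mul_single, Matrix.diagonal_mul]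
      simp
      ring
  simp only [skewUnit, Matrix.sub_mul, Matrix.mul_sub, Matrix.trace_sub, (h _ _ _).1, (h _ _ _).2]
  ring

/-- Tr Φ⁴ is invariant under conjugation, so only the E-dependent part varies, with Φ² moving by [B,
Φ²]. -/
theorem fderiv_splitAction_adLin {i j : Fin N} (z : ℂ) (x : HermCoord N) :
    fderiv ℝ (splitAction η E) x (adLin (skewUnit i j z) x) =
      2 * N * (E i - E j) * (conj z * (toMatrix x ^ 2) i j).re := by
  have h : (toMatrix x ^ 2 * (skewUnit i j z * toMatrix x ^ 2 -
      toMatrix x ^ 2 * skewUnit i j z)).trace = 0 := by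
    rw [mul_sub, Matrix.trace_sub, ← mul_assoc, Matrix.trace_mul_comm _ (toMatrix x ^ 2), sub_self]
  rw [fderiv_splitAction, sq_adLin (skewUnit_conjTranspose i j z), h,
    trace_diagonal_mul_skewUnit_commutator, ← toMatrix_sq_conj x i j, ← Complex.ofReal_sub,
    Complex.re_ofReal_mul]
  simp
  ring

/-- The Ward identity of the conjugations generated by `z e_ij - z̄ e_ji`. -/
theorem moment_ward_aux (hN : 1 ≤ N) (hη : 0 < η) (hE : ∀ i, 0 < E i) {i j : Fin N} (hij : i ≠ j)
    {z : ℂ} (hz : Complex.normSq z = 1) :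
    moment η (diagSq j) E - moment η (diagSq i) E =
      2 * N ^ 2 * (E i - E j) *
        moment η (fun x => (conj z * (toMatrix x ^ 2) i j).re ^ 2) E := by
  obtain ⟨c, hc, hcS⟩ := exists_splitAction_lower_bound hN hη hE
  -- The test function is, up to a constant, the variation of the action itself, so the action term
  -- becomes a square. Its own variation is (Φ²)_jj - (Φ²)_ii because |z| = 1.
  have hg : (fun x : HermCoord N => (conj z * (toMatrix x ^ 2) i j).re).HasTemperateGrowth :=
    hasTemperateGrowth_re
      ((Function.HasTemperateGrowth.const _).fun_mul (hasTemperateGrowth_sq_apply i j))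
  have h := integral_fderiv_linear_field (μ := (volume : Measure (HermCoord N)))
    (adLin (skewUnit i j z)) hg (hasTemperateGrowth_splitAction η E) hc hcS
  have h1 : ∀ x : HermCoord N, fderiv ℝ (fun x => (conj z * (toMatrix x ^ 2) i j).re) x
      (adLin (skewUnit i j z) x) = ((toMatrix x ^ 2) j j).re - ((toMatrix x ^ 2) i i).re := by
    intro x
    have h2 : HasFDerivAt (fun x => (conj z * (toMatrix x ^ 2) i j).re)
        (Complex.reCLM ∘L (conj z • sqDeriv i j x)) x :=
      Complex.reCLM.hasFDerivAt.comp x ((hasFDerivAt_sq_apply i j x).const_mul (conj z))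
    rw [h2.fderiv, ContinuousLinearMap.comp_apply, _root_.smul_apply, sqDeriv_apply,
      sq_adLin (skewUnit_conjTranspose i j z), skewUnit_commutator_apply hij, smul_eq_mul,
      ← mul_assoc, ← Complex.normSq_eq_conj_mul_self, hz]
    simp
  rw [trace_adLin_skewUnit hij, zero_mul, neg_zero] at h
  have hi : ∀ i, Integrable fun x => diagSq i x * Real.exp (-splitAction η E x) := fun i =>
    integrable_mul_exp_neg_splitAction hN hη hE (hasTemperateGrowth_diagSq i)
  have hq : Integrable fun x : HermCoord N =>
      (conj z * (toMatrix x ^ 2) i j).re ^ 2 * Real.exp (-splitAction η E x) :=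
    integrable_mul_exp_neg_splitAction hN hη hE (hg.fun_pow 2)
  have hji : Integrable fun x => diagSq j x * Real.exp (-splitAction η E x) -
      diagSq i x * Real.exp (-splitAction η E x) := (hi j).sub (hi i)
  have hN' : (N : ℝ) ≠ 0 := by
    have : N ≠ 0 := by omega
    exact_mod_cast this
  have hpt : ∀ x : HermCoord N,
      ((toMatrix x ^ 2) j j).re - ((toMatrix x ^ 2) i i).re = (diagSq j x - diagSq i x) / N := by
    intro x
    simp only [diagSq]
    field_simp
  simp only [h1, hpt, fderiv_splitAction_adLin] at h
  have hpt2 : ∀ x : HermCoord N, ((diagSq j x - diagSq i x) / N -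
      (conj z * (toMatrix x ^ 2) i j).re * (2 * N * (E i - E j) *
        (conj z * (toMatrix x ^ 2) i j).re)) * Real.exp (-splitAction η E x) =
      (N : ℝ)⁻¹ * (diagSq j x * Real.exp (-splitAction η E x) -
        diagSq i x * Real.exp (-splitAction η E x)) - 2 * N * (E i - E j) *
        ((conj z * (toMatrix x ^ 2) i j).re ^ 2 * Real.exp (-splitAction η E x)) := by
    intro x
    ring
  simp only [hpt2] at h
  rw [integral_sub (hji.const_mul _) (hq.const_mul _), integral_const_mul,
    integral_const_mul, integral_sub (hi j) (hi i), ← moment_eq, ← moment_eq, ← moment_eq] at h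
  field_simp at h
  linarith

/-- The generators with z = 1 and z = √-1 supply the squares of the real and imaginary parts of
(Φ²)_ij; averaging the two identities gives the modulus. -/
theorem moment_ward (hN : 1 ≤ N) (hη : 0 < η) (hE : ∀ i, 0 < E i) {i j : Fin N} (hij : i ≠ j) :
    moment η (diagSq j) E - moment η (diagSq i) E =
      N ^ 2 * (E i - E j) * moment η (fun x => Complex.normSq ((toMatrix x ^ 2) i j)) E := by
  have h1 := moment_ward_aux hN hη hE hij (z := 1) (by simp)
  have h2 := moment_ward_aux hN hη hE hij (z := Complex.I) (by simp)
  have hre := integrable_mul_exp_neg_splitAction hN hη hE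
    ((hasTemperateGrowth_re (hasTemperateGrowth_sq_apply i j)).fun_pow 2)
  have him := integrable_mul_exp_neg_splitAction hN hη hE
    ((hasTemperateGrowth_im (hasTemperateGrowth_sq_apply i j)).fun_pow 2)
  have h3 : moment η (fun x => Complex.normSq ((toMatrix x ^ 2) i j)) E =
      moment η (fun x => ((toMatrix x ^ 2) i j).re ^ 2) E +
        moment η (fun x => ((toMatrix x ^ 2) i j).im ^ 2) E := by
    rw [moment_eq, moment_eq, moment_eq, ← integral_add hre him]
    simp only [Complex.normSq_apply, pow_two, add_mul]
  simp at h1 h2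
  rw [h3]
  linarith

theorem moment_quartic (hN : 1 ≤ N) (hη : 0 < η) (hE : ∀ i, 0 < E i)
    (hinj : Function.Injective E) :
    N ^ 2 * moment η quartic E = ∑ i, moment η (fun x => diagSq i x * diagSq i x) E +
      ∑ i, ∑ j, (moment η (diagSq j) E - moment η (diagSq i) E) / (E i - E j) := by
  have hi : ∀ i j, Integrable fun x : HermCoord N => Complex.normSq ((toMatrix x ^ 2) i j) *
      Real.exp (-splitAction η E x) := fun i j =>
    integrable_mul_exp_neg_splitAction hN hη hE
      (hasTemperateGrowth_normSq (hasTemperateGrowth_sq_apply i j))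
  have h1 : moment η quartic E =
      ∑ i, ∑ j, moment η (fun x : HermCoord N => Complex.normSq ((toMatrix x ^ 2) i j)) E := by
    simp only [moment_eq, quartic, Finset.sum_mul]
    rw [integral_finsetSum _ fun i _ => integrable_finsetSum _ fun j _ => hi i j]
    exact Finset.sum_congr rfl fun i _ => integral_finsetSum _ fun j _ => hi i j
  rw [h1, Finset.mul_sum, ← Finset.sum_add_distrib]
  refine Finset.sum_congr rfl fun i _ => ?_
  -- The term j = i is split off on both sides: the quotient there is 0/0 = 0, and since (Φ²)_ii is
  -- real, N² |(Φ²)_ii|² is the square of `diagSq i`.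
  rw [Finset.mul_sum, ← Finset.add_sum_erase _ _ (Finset.mem_univ i),
    ← Finset.add_sum_erase (a := i) (s := Finset.univ)
      (f := fun j => (moment η (diagSq j) E - moment η (diagSq i) E) / (E i - E j))
      (Finset.mem_univ i), sub_self, zero_div, zero_add]
  congr 1
  · rw [moment_eq, moment_eq, ← integral_const_mul]
    congr 1
    ext x
    have him : ((toMatrix x ^ 2) i i).im = 0 := Complex.conj_eq_iff_im.1 (toMatrix_sq_conj x i i)
    rw [Complex.normSq_apply, him, diagSq]
    ring
  · refine Finset.sum_congr rfl fun j hj => ?_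
    have hij : i ≠ j := (Finset.ne_of_mem_erase hj).symm
    have hne : E i - E j ≠ 0 := sub_ne_zero.2 (hinj.ne hij)
    rw [moment_ward hN hη hE hij]
    field_simp

theorem hasDerivAt_moment_update (hN : 1 ≤ N) (hη : 0 < η) {p : HermCoord N → ℝ}
    (hp : p.HasTemperateGrowth) (hE : ∀ i, 0 < E i) (i : Fin N) {t : ℝ} (ht : 0 < t) :
    HasDerivAt (fun t => moment η p (Function.update E i t))
      (-moment η (fun x => p x * diagSq i x) (Function.update E i t)) t :=
  hasDerivAt_laplaceIntegral_update hasTemperateGrowth_diagSq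
    ((Function.HasTemperateGrowth.const _).fun_mul hasTemperateGrowth_quartic) diagSq_nonneg
    (fun x => mul_nonneg (by positivity) (quartic_nonneg x)) (by exact_mod_cast hN)
    mul_norm_sq_le_sum_diagSq hp hE i ht

theorem contDiffOn_moment (hN : 1 ≤ N) (hη : 0 < η) {p : HermCoord N → ℝ}
    (hp : p.HasTemperateGrowth) (n : ℕ) :
    ContDiffOn ℝ n (moment η p) {E : Fin N → ℝ | ∀ i, 0 < E i} :=
  contDiffOn_laplaceIntegral hasTemperateGrowth_diagSq
    ((Function.HasTemperateGrowth.const _).fun_mul hasTemperateGrowth_quartic) diagSq_nonneg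
    (fun x => mul_nonneg (by positivity) (quartic_nonneg x)) (by exact_mod_cast hN)
    mul_norm_sq_le_sum_diagSq hp n

end SchwingerDyson

/-! ### Derivatives of the prefactor, rational identities and the Schrödinger equation -/

noncomputable section HarmonicOscillator

variable {N : ℕ}

theorem isOpen_positiveNondegenerate (N : ℕ) : IsOpen (positiveNondegenerate N) := by
  have h : positiveNondegenerate N = {E : Fin N → ℝ | ∀ i, 0 < E i} ∩
      ⋂ i, ⋂ j, {E : Fin N → ℝ | i ≠ j → E i ≠ E j} := by
    ext E
    simp only [positiveNondegenerate, Set.mem_ofPred_eq, Set.mem_inter_iff, Set.mem_iInter]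
    refine and_congr_right fun _ => ⟨fun h i j hij => h.ne hij, fun h i j hij => ?_⟩
    by_contra hne
    exact h i j hne hij
  rw [h]
  refine isOpen_forall_pos.inter (isOpen_iInter_of_finite fun i => isOpen_iInter_of_finite fun j =>
    ?_)
  by_cases hij : i = j
  · simp [hij]
  · simpa [hij] using isOpen_ne_fun (continuous_apply i) (continuous_apply j)

theorem hasDerivAt_prod_of_log {ι : Type*} (s : Finset ι) {f : ι → ℝ → ℝ} {g : ι → ℝ} {t : ℝ}
    (h : ∀ k ∈ s, HasDerivAt (f k) (f k t * g k) t) :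
    HasDerivAt (fun t => ∏ k ∈ s, f k t) ((∏ k ∈ s, f k t) * ∑ k ∈ s, g k) t := by
  classical
  induction s using Finset.induction_on with
  | empty => simpa using hasDerivAt_const t (1 : ℝ)
  | insert a s ha ih =>
    simp only [Finset.prod_insert ha, Finset.sum_insert ha]
    refine ((h a (Finset.mem_insert_self a s)).mul
      (ih fun k hk => h k (Finset.mem_insert_of_mem hk))).congr_deriv ?_
    ring

/-- This is ∂_i log Δ: the pairs k < l with l = i give the terms j < i, those with k = i the terms j
> i, and the term j = i is 0⁻¹ = 0. -/
theorem sum_sum_Ioi_single (F : Fin N → ℝ) (i : Fin N) :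
    ∑ k, ∑ l ∈ Finset.Ioi k,
      ((Pi.single i 1 : Fin N → ℝ) l - (Pi.single i 1 : Fin N → ℝ) k) / (F l - F k) =
      ∑ j, (F i - F j)⁻¹ := by
  have h : ∀ k, ∑ l ∈ Finset.Ioi k,
      ((Pi.single i 1 : Fin N → ℝ) l - (Pi.single i 1 : Fin N → ℝ) k) / (F l - F k) =
      (if k < i then (F i - F k)⁻¹ else 0) +
        if k = i then ∑ l ∈ Finset.Ioi i, (F i - F l)⁻¹ else 0 := by
    intro k
    simp only [sub_div, Finset.sum_sub_distrib, Pi.single_apply, ite_div, zero_div, one_div,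
      Finset.sum_ite_eq', Finset.mem_Ioi, sub_eq_add_neg (G := ℝ) (if k < i then _ else _)]
    congr 1
    split_ifs with hk
    · subst hk
      rw [← Finset.sum_neg_distrib]
      exact Finset.sum_congr rfl fun l _ => by rw [← inv_neg, neg_sub]
    · simp
  simp only [h, Finset.sum_add_distrib, Finset.sum_ite_eq', Finset.mem_univ, if_true]
  rw [← Finset.sum_filter, ← Finset.sum_filter_add_sum_filter_not Finset.univ (fun j => j < i)]
  congr 1
  rw [← Finset.add_sum_erase _ _ (show i ∈ Finset.univ.filter fun j => ¬ j < i by simp)]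
  simp only [sub_self, inv_zero, zero_add]
  refine Finset.sum_congr ?_ fun _ _ => rfl
  ext j
  simp [lt_iff_le_and_ne, and_comm, eq_comm]
  tauto

theorem hasDerivAt_vandermondeDet_update {E : Fin N → ℝ} {i : Fin N} {t : ℝ}
    (h : Function.Injective (Function.update E i t)) :
    HasDerivAt (fun t => vandermondeDet (Function.update E i t))
      (vandermondeDet (Function.update E i t) *
        ∑ j, (Function.update E i t i - Function.update E i t j)⁻¹) t := by
  rw [← sum_sum_Ioi_single]
  refine hasDerivAt_prod_of_log _ fun k _ => hasDerivAt_prod_of_log _ fun l hl => ?_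
  have hne : Function.update E i t l - Function.update E i t k ≠ 0 :=
    sub_ne_zero.2 (h.ne (Finset.mem_Ioi.1 hl).ne')
  have hd := hasDerivAt_pi.1 (hasDerivAt_update E i t)
  refine ((hd l).sub (hd k)).congr_deriv ?_
  field_simp

theorem hasDerivAt_sum_inv_sub_update {E : Fin N → ℝ} {i : Fin N} {t : ℝ}
    (h : Function.Injective (Function.update E i t)) :
    HasDerivAt (fun t => ∑ j, (Function.update E i t i - Function.update E i t j)⁻¹)
      (-∑ j, ((Function.update E i t i - Function.update E i t j)⁻¹) ^ 2) t := by
  rw [← Finset.sum_neg_distrib]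
  refine HasDerivAt.fun_sum fun j _ => ?_
  rcases eq_or_ne j i with rfl | hj
  · simpa using hasDerivAt_const t (0 : ℝ)
  · have hne : Function.update E i t i - Function.update E i t j ≠ 0 :=
      sub_ne_zero.2 (h.ne hj.symm)
    simp only [Function.update_self, Function.update_of_ne hj] at hne ⊢
    refine (((hasDerivAt_id t).sub_const (E j)).inv hne).congr_deriv ?_
    simp [neg_div]

theorem hasDerivAt_gaussian_update (c : ℝ) (E : Fin N → ℝ) (i : Fin N) (t : ℝ) :
    HasDerivAt (fun t => Real.exp (-c * ∑ j, Function.update E i t j ^ 2))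
      (Real.exp (-c * ∑ j, Function.update E i t j ^ 2) * (-(2 * c) * t)) t := by
  have h : HasDerivAt (fun t => ∑ j, Function.update E i t j ^ 2) (2 * t) t := by
    refine (HasDerivAt.fun_sum fun j _ =>
      (hasDerivAt_pi.1 (hasDerivAt_update E i t) j).fun_pow 2).congr_deriv ?_
    simp [Pi.single_apply]
  refine ((h.const_mul (-c)).exp).congr_deriv ?_
  ring

variable {η : ℝ} {E : Fin N → ℝ}

/-- With a the prefactor and a' = ab, one has (aZ)'' = a((b² + b')Z + 2bZ' + Z''); every term keeps
the factor a. -/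
theorem secondPartial_Psi (hN : 1 ≤ N) (hη : 0 < η) (hE : E ∈ positiveNondegenerate N)
    (i : Fin N) :
    secondPartial i (Psi η) E =
      Real.exp (-((N : ℝ) / (2 * η)) * ∑ i, E i ^ 2) * vandermondeDet E *
      (((-(N / η) * E i + ∑ j, (E i - E j)⁻¹) ^ 2 - N / η - ∑ j, ((E i - E j)⁻¹) ^ 2) *
          moment η (fun _ => 1) E -
        2 * (-(N / η) * E i + ∑ j, (E i - E j)⁻¹) * moment η (diagSq i) E +
        moment η (fun x => diagSq i x * diagSq i x) E) := by
  set F := fun t => Function.update E i t with hF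
  set a : ℝ → ℝ := fun t => Real.exp (-((N : ℝ) / (2 * η)) * ∑ i, F t i ^ 2) *
    vandermondeDet (F t) with ha
  set b : ℝ → ℝ := fun t => -(N / η) * t + ∑ j, (F t i - F t j)⁻¹ with hb
  -- The first-derivative formula must hold on a whole neighbourhood before it can be differentiated
  -- again.
  have hopen : ∀ᶠ t in nhds (E i), F t ∈ positiveNondegenerate N := by
    have hcont : Continuous F := continuous_const.update i continuous_id
    refine hcont.continuousAt.eventually_mem ((isOpen_positiveNondegenerate N).mem_nhds ?_)
    simpa [hF] using hE
  have hFi : ∀ t, F t i = t := fun t => by simp [hF]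
  have ha' : ∀ t, F t ∈ positiveNondegenerate N → HasDerivAt a (a t * b t) t := by
    intro t ht
    refine ((hasDerivAt_gaussian_update _ E i t).mul
      (hasDerivAt_vandermondeDet_update ht.2)).congr_deriv ?_
    simp only [ha, hb, hF]
    field_simp
  have hb' : ∀ t, F t ∈ positiveNondegenerate N →
      HasDerivAt b (-(N / η) + -∑ j, ((F t i - F t j)⁻¹) ^ 2) t := by
    intro t ht
    refine (((hasDerivAt_id t).const_mul (-(N / η))).add
      (hasDerivAt_sum_inv_sub_update ht.2)).congr_deriv ?_
    simp [hF]
  have hz : ∀ t, F t ∈ positiveNondegenerate N → HasDerivAt (fun t => moment η (fun _ => 1) (F t))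
      (-moment η (diagSq i) (F t)) t := by
    intro t ht
    have := hasDerivAt_moment_update hN hη (p := fun _ => 1) (by fun_prop) hE.1 i
      (by simpa [hFi] using ht.1 i)
    simpa using this
  have hz' : ∀ t, F t ∈ positiveNondegenerate N → HasDerivAt (fun t => moment η (diagSq i) (F t))
      (-moment η (fun x => diagSq i x * diagSq i x) (F t)) t := by
    intro t ht
    exact hasDerivAt_moment_update hN hη (hasTemperateGrowth_diagSq i) hE.1 i
      (by simpa [hFi] using ht.1 i)
  have hPsi : (fun t => Psi η (F t)) = fun t => a t * moment η (fun _ => 1) (F t) := by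
    ext t
    rw [Psi, Z_eq_moment]
  have hd1 : deriv (fun t => Psi η (F t)) =ᶠ[nhds (E i)] fun t =>
      a t * (b t * moment η (fun _ => 1) (F t) - moment η (diagSq i) (F t)) := by
    filter_upwards [hopen] with t ht
    rw [hPsi, ((ha' t ht).fun_mul (hz t ht)).deriv]
    ring
  have hEi := hopen.self_of_nhds
  have hd2 := (ha' _ hEi).mul (((hb' _ hEi).mul (hz _ hEi)).sub (hz' _ hEi))
  rw [secondPartial, iteratedDeriv_succ, iteratedDeriv_one, hd1.deriv_eq]
  refine hd2.deriv.trans ?_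
  have hFE : F (E i) = E := by simp [hF]
  simp only [ha, hb, hFE, Pi.mul_apply, Pi.sub_apply]
  ring

theorem sum_sum_symm (f : Fin N → Fin N → ℝ) :
    2 * ∑ i, ∑ j, f i j = ∑ i, ∑ j, (f i j + f j i) := by
  simp only [Finset.sum_add_distrib]
  rw [two_mul]
  congr 1
  exact Finset.sum_comm

/-- Symmetrising in i and j turns each of the N(N - 1) off-diagonal terms into 1; the diagonal terms
vanish since 0⁻¹ = 0. -/
theorem sum_mul_sum_inv_sub (hE : Function.Injective E) :
    2 * ∑ i, E i * ∑ j, (E i - E j)⁻¹ = N * (N - 1) := by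
  simp only [Finset.mul_sum (s := Finset.univ) (f := fun j => (E _ - E j)⁻¹)]
  rw [sum_sum_symm]
  have h : ∀ i j, E i * (E i - E j)⁻¹ + E j * (E j - E i)⁻¹ = 1 - if i = j then 1 else 0 := by
    intro i j
    rcases eq_or_ne i j with rfl | hij
    · simp
    · have h1 : E i - E j ≠ 0 := sub_ne_zero.2 (hE.ne hij)
      have h2 : E j - E i ≠ 0 := sub_ne_zero.2 (hE.ne hij.symm)
      rw [if_neg hij]
      field_simp
      ring
  simp only [h, Finset.sum_sub_distrib, Finset.sum_ite_eq, Finset.mem_univ, if_true]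
  simp
  ring

/-- The cross terms j ≠ k of the square cancel by 1/((x-y)(x-w)) + 1/((y-w)(y-x)) + 1/((w-x)(w-y)) =
0, summed over cyclic permutations. When two indices coincide, every term of the cyclic sum is 0,
through 0⁻¹ = 0 or the convention j = k in `T`. -/
theorem sum_sq_sum_inv_sub (hE : Function.Injective E) :
    ∑ i, (∑ j, (E i - E j)⁻¹) ^ 2 = ∑ i, ∑ j, ((E i - E j)⁻¹) ^ 2 := by
  set T : Fin N → Fin N → Fin N → ℝ := fun i j k =>
    if j = k then 0 else (E i - E j)⁻¹ * (E i - E k)⁻¹ with hT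
  have hcyc : ∀ i j k, T i j k + T j k i + T k i j = 0 := by
    intro i j k
    simp only [hT]
    by_cases hij : i = j
    · subst hij; simp
    by_cases hjk : j = k
    · subst hjk; simp
    by_cases hki : k = i
    · subst hki; simp
    rw [if_neg hij, if_neg hjk, if_neg hki]
    have h1 : E i - E j ≠ 0 := sub_ne_zero.2 (hE.ne hij)
    have h2 : E j - E k ≠ 0 := sub_ne_zero.2 (hE.ne hjk)
    have h3 : E k - E i ≠ 0 := sub_ne_zero.2 (hE.ne hki)
    rw [← neg_sub (E i) (E j), ← neg_sub (E j) (E k), ← neg_sub (E k) (E i)]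
    simp only [inv_neg]
    field_simp
    ring
  have h1 : ∑ i, ∑ j, ∑ k, T j k i = ∑ i, ∑ j, ∑ k, T i j k := by
    rw [Finset.sum_comm]
    exact Finset.sum_congr rfl fun j _ => Finset.sum_comm
  have h2 : ∑ i, ∑ j, ∑ k, T k i j = ∑ i, ∑ j, ∑ k, T i j k := by
    rw [Finset.sum_congr rfl fun i _ => Finset.sum_comm, Finset.sum_comm]
  have h3 : ∑ i, ∑ j, ∑ k, T i j k = 0 := by
    have : ∑ i, ∑ j, ∑ k, (T i j k + T j k i + T k i j) = 0 := by simp [hcyc]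
    simp only [Finset.sum_add_distrib, h1, h2] at this
    linarith
  have h4 : ∀ i j, ∑ k, T i j k = (∑ k, (E i - E j)⁻¹ * (E i - E k)⁻¹) - ((E i - E j)⁻¹) ^ 2 := by
    intro i j
    have : ∀ k, T i j k = (E i - E j)⁻¹ * (E i - E k)⁻¹ -
        if j = k then ((E i - E j)⁻¹) ^ 2 else 0 := by
      intro k
      simp only [hT]
      split_ifs with h
      · subst h; ring
      · ring
    simp [this]
  simp only [h4, Finset.sum_sub_distrib, ← Finset.mul_sum, ← Finset.sum_mul, ← pow_two] at h3
  linarith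

theorem hamiltonianHO_Psi (hN : 1 ≤ N) (hη : 0 < η) (hE : E ∈ positiveNondegenerate N) :
    hamiltonianHO η (Psi η) E = 0 := by
  have hN' : (N : ℝ) ≠ 0 := by
    have : N ≠ 0 := by omega
    exact_mod_cast this
  have hdil := moment_dilation hN hη hE.1
  have hquart := moment_quartic hN hη hE.1 hE.2
  have hA := sum_sq_sum_inv_sub hE.2
  have hB := sum_mul_sum_inv_sub hE.2
  -- Antisymmetry of 1/(E_i - E_j) turns the Ward term into the first-order term created by the
  -- Vandermonde factor, so the two can cancel.
  have hC : ∑ i, ∑ j, (moment η (diagSq j) E - moment η (diagSq i) E) / (E i - E j) =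
      -(2 * ∑ i, (∑ j, (E i - E j)⁻¹) * moment η (diagSq i) E) := by
    simp only [Finset.sum_mul]
    rw [sum_sum_symm, ← Finset.sum_neg_distrib]
    refine Finset.sum_congr rfl fun i _ => ?_
    rw [← Finset.sum_neg_distrib]
    refine Finset.sum_congr rfl fun j _ => ?_
    rw [← neg_sub (E i) (E j), inv_neg]
    ring
  rw [hC] at hquart
  rw [hamiltonianHO, Psi, Z_eq_moment]
  simp only [secondPartial_Psi hN hη hE, ← Finset.mul_sum]
  set z := moment η (fun _ => 1) E
  set r : Fin N → ℝ := fun i => ∑ j, (E i - E j)⁻¹ with hr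
  set a := Real.exp (-((N : ℝ) / (2 * η)) * ∑ i, E i ^ 2) * vandermondeDet E
  have hsum : ∑ i, (((-(N / η) * E i + r i) ^ 2 - N / η - ∑ j, ((E i - E j)⁻¹) ^ 2) * z -
      2 * (-(N / η) * E i + r i) * moment η (diagSq i) E +
      moment η (fun x => diagSq i x * diagSq i x) E) =
      ((N / η) ^ 2 * (∑ i, E i ^ 2) - (N / η) * (2 * ∑ i, E i * r i) + ∑ i, r i ^ 2 -
        N * (N / η) - ∑ i, ∑ j, ((E i - E j)⁻¹) ^ 2) * z +
      2 * (N / η) * (∑ i, E i * moment η (diagSq i) E) -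
      2 * (∑ i, r i * moment η (diagSq i) E) +
      ∑ i, moment η (fun x => diagSq i x * diagSq i x) E := by
    have hterm : ∀ i, ((-(N / η) * E i + r i) ^ 2 - N / η - ∑ j, ((E i - E j)⁻¹) ^ 2) * z -
        2 * (-(N / η) * E i + r i) * moment η (diagSq i) E +
        moment η (fun x => diagSq i x * diagSq i x) E =
        ((N / η) ^ 2 * E i ^ 2 - (N / η) * (2 * (E i * r i)) + r i ^ 2 - N / η -
          ∑ j, ((E i - E j)⁻¹) ^ 2) * z + 2 * (N / η) * (E i * moment η (diagSq i) E) -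
        2 * (r i * moment η (diagSq i) E) + moment η (fun x => diagSq i x * diagSq i x) E :=
      fun i => by ring
    simp only [hterm, Finset.sum_add_distrib, Finset.sum_sub_distrib, ← Finset.sum_mul,
      ← Finset.mul_sum]
    simp
  rw [hsum, hA, hB]
  have hq : ∑ i, moment η (fun x => diagSq i x * diagSq i x) E -
      2 * ∑ i, r i * moment η (diagSq i) E = N ^ 2 * moment η quartic E := by
    rw [hquart]; ring
  have hq' : ∑ i, moment η (fun x => diagSq i x * diagSq i x) E =
      N ^ 2 * moment η quartic E + 2 * ∑ i, r i * moment η (diagSq i) E := by linarith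
  have hd : ∑ i, E i * moment η (diagSq i) E =
      (N ^ 2 * z - η * N * moment η quartic E) / 2 := by linarith
  -- The moments ⟨Tr Φ⁴⟩ now occur as N² - (N/η)·ηN = 0. The coefficients of z from N(N - 1), from
  -- the Gaussian and from the dilation equation add up to (N/η)(-N(N - 1) - N + N²) = 0, which
  -- leaves (N/η)² ∑ E_i² z.
  rw [hq', hd]
  field_simp
  ring

theorem contDiffOn_Psi (hN : 1 ≤ N) (hη : 0 < η) (n : ℕ) :
    ContDiffOn ℝ n (Psi η) (positiveNondegenerate N) := by
  have h1 : ContDiff ℝ n (fun E : Fin N → ℝ =>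
      Real.exp (-((N : ℝ) / (2 * η)) * ∑ i, E i ^ 2) * vandermondeDet E) := by
    unfold vandermondeDet
    refine ContDiff.mul (by fun_prop) (contDiff_prod fun k _ => contDiff_prod fun l _ => ?_)
    fun_prop
  have h2 : ContDiffOn ℝ n (Z η) (positiveNondegenerate N) :=
    ((contDiffOn_moment hN hη (p := fun _ => 1) (by fun_prop) n).mono fun E hE => hE.1).congr
      fun E _ => Z_eq_moment η E
  exact h1.contDiffOn.mul h2

end HarmonicOscillator

end PhiFour

theorem theorem1 (N : ℕ) (hN : 1 ≤ N) (η : ℝ) (hη : 0 < η) :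
    (∀ E ∈ PhiFour.positiveNondegenerate N,
      MeasureTheory.Integrable (fun x : PhiFour.HermCoord N => PhiFour.weight η E x)) ∧
    ContDiffOn ℝ 2 (fun E : Fin N → ℝ => PhiFour.Psi η E) (PhiFour.positiveNondegenerate N) ∧
    ∀ E ∈ PhiFour.positiveNondegenerate N,
      PhiFour.hamiltonianHO η (fun E' : Fin N → ℝ => PhiFour.Psi η E') E = 0 :=
  ⟨fun _ hE => PhiFour.integrable_weight hN hη hE.1, PhiFour.contDiffOn_Psi hN hη 2,
    fun _ hE => PhiFour.hamiltonianHO_Psi hN hη hE⟩
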